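/- For $n \ge 0$ let $S_n(231)$ be the set of permutations $\sigma = [\sigma_1,\dots,\sigma_n]$ of $\{1,\dots,n\}$ that avoid the pattern $231$, that is, for which there are no indices $i<j<k$ with $\sigma_k<\sigma_i<\sigma_j$. Let $\operatorname{maj}(\sigma)$ be the sum of all $i$ with $1\le i<n$ and $\sigma_i>\sigma_{i+1}$, let $\operatorname{imaj}(\sigma)=\operatorname{maj}(\sigma^{-1})$, and let $$A_n(q,t)=\sum_{\sigma\in S_n(231)} q^{\operatorname{maj}(\sigma)}\,t^{\binom n2-\operatorname{imaj}(\sigma)}\in\mathbb{Z}[q,t].$$ Then, in the ring $\mathbb{Z}[q,t][[z]]$ of formal power series in $z$ (the sum over $n$ converging coefficientwise), $$\sum_{n\ge 0}\frac{A_n(q,t)\,z^n}{\prod_{i=0}^{n}(1+q^i z)\;\prod_{i=1}^{n}(1+t^i z)}=1 .$$ -/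

import Mathlib

open scoped PowerSeries.WithPiTopology

namespace Perm231

/-- The permutation `σ` of `n` letters (with one-line notation `σ 0, …, σ (n - 1)`) is
`231`-avoiding: there are no positions `i < j < k` with `σ k < σ i < σ j`. -/
def Avoids231 {n : ℕ} (σ : Equiv.Perm (Fin n)) : Prop :=
  ∀ i j k : Fin n, i < j → j < k → ¬ (σ k < σ i ∧ σ i < σ j)

instance {n : ℕ} (σ : Equiv.Perm (Fin n)) : Decidable (Avoids231 σ) := by
  unfold Avoids231; infer_instance

/-- The descent set of `σ`, with positions numbered from `1`: the integers `1 ≤ i < n` such that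
the `i`-th letter of `σ` is larger than its `(i + 1)`-st letter. With positions numbered from `0`,
these are the letters at `i - 1` and at `i`. -/
def Des {n : ℕ} (σ : Equiv.Perm (Fin n)) : Finset ℕ :=
  (Finset.Ico 1 n).filter fun i =>
    ∃ h : i < n, σ ⟨i, h⟩ < σ ⟨i - 1, lt_of_le_of_lt (Nat.sub_le i 1) h⟩

/-- The major index: the sum of the descents. -/
def maj {n : ℕ} (σ : Equiv.Perm (Fin n)) : ℕ := ∑ i ∈ Des σ, i

/-- The inverse major index: the major index of the inverse permutation. -/
def imaj {n : ℕ} (σ : Equiv.Perm (Fin n)) : ℕ := maj σ⁻¹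

/-- The subtraction `n.choose 2 - imaj σ` never truncates. -/
theorem imaj_le_choose_two {n : ℕ} (σ : Equiv.Perm (Fin n)) : imaj σ ≤ n.choose 2 := by
  have h : Des σ⁻¹ ⊆ Finset.range n := fun i hi =>
    Finset.mem_range.2 (Finset.mem_Ico.1 (Finset.mem_filter.1 hi).1).2
  calc imaj σ ≤ ∑ i ∈ Finset.range n, i := Finset.sum_le_sum_of_subset h
    _ = n.choose 2 := Finset.sum_range_id n |>.trans (Nat.choose_two_right n).symm

/-- The ring of polynomials with integer coefficients in the two variables `q` and `t`. -/
abbrev Poly : Type := MvPolynomial (Fin 2) ℤ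

/-- The variable `q`. -/
noncomputable def q : Poly := MvPolynomial.X 0

/-- The variable `t`. -/
noncomputable def t : Poly := MvPolynomial.X 1

/-- The polynomial `A_n(q,t)`, the sum of `q ^ maj σ * t ^ (n.choose 2 - imaj σ)` over all
`231`-avoiding permutations `σ` of `n` letters. -/
noncomputable def A (n : ℕ) : Poly :=
  ∑ σ : Equiv.Perm (Fin n) with Avoids231 σ, q ^ maj σ * t ^ (n.choose 2 - imaj σ)

/-- The power series `(1 + z)(1 + qz)⋯(1 + qⁿz) · (1 + tz)⋯(1 + tⁿz)` in `z`. -/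
noncomputable def denom (n : ℕ) : PowerSeries Poly :=
  (∏ i ∈ Finset.Icc 0 n, (1 + PowerSeries.C (q ^ i) * PowerSeries.X)) *
    ∏ i ∈ Finset.Icc 1 n, (1 + PowerSeries.C (t ^ i) * PowerSeries.X)

/-- The inverse of `denom n` in the ring of formal power series. -/
noncomputable def denomInv (n : ℕ) : PowerSeries Poly := PowerSeries.invOfUnit (denom n) 1

theorem denom_mul_denomInv (n : ℕ) : denom n * denomInv n = 1 :=
  PowerSeries.mul_invOfUnit _ _ (by simp [denom, map_prod])

/-- The `n`-th summand `A_n(q,t) zⁿ / ((1 + z)(1 + qz)⋯(1 + qⁿz) · (1 + tz)⋯(1 + tⁿz))`. -/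
noncomputable def summand (n : ℕ) : PowerSeries Poly :=
  PowerSeries.C (A n) * PowerSeries.X ^ n * denomInv n

end Perm231

/-! Build a `231`-avoider by appending its last letter `v`, which must be at least the old last
letter (`avoids231_insertLast_iff`). If the two are equal, a descent at the end contributes `q ^ (n
+ 1)`; otherwise the inverse gains one ascent and contributes `t ^ v`. This is a triangular
recurrence on the last letter, and `sum_range_eq_coeff_ballotSeries` solves it: `A (n + 1)` is the
coefficient of `X ^ n` in `B_n`, where `B_s` is `ballotSeries` with weights `q ^ i` and `t ^ i`.
That coefficient is exactly what the recursion for `B_{n+1}` subtracts, so the summands telescope: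
the remainder after the term `N` is `X * B_N * denomInv N`. It is divisible by `X ^ (N + 1)`, hence
vanishes in the limit. -/

namespace Perm231

/-! ### Ballot series and the triangular recurrence. -/

section Algebra

open PowerSeries

variable {R : Type*} [CommRing R]

theorem coeff_zero_one_add_C_mul_X_mul (a : R) (f : PowerSeries R) :
    coeff 0 ((1 + C a * X) * f) = coeff 0 f := by
  simp

theorem coeff_succ_one_add_C_mul_X_mul (a : R) (f : PowerSeries R) (k : ℕ) :
    coeff (k + 1) ((1 + C a * X) * f) = coeff (k + 1) f + a * coeff k f := by
  rw [add_mul, one_mul, map_add, mul_assoc, coeff_C_mul, coeff_succ_X_mul]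

theorem coeff_prod_one_add_C_mul_X_eq_zero (a : ℕ → R) (S : Finset ℕ) {k : ℕ} (hk : S.card < k) :
    coeff k (∏ i ∈ S, (1 + C (a i) * X)) = 0 := by
  induction S using Finset.induction_on generalizing k with
  | empty =>
    have hk0 : k ≠ 0 := (by simpa using hk : 0 < k).ne'
    simp [coeff_one, hk0]
  | insert x S hx ih =>
    obtain ⟨k, rfl⟩ : ∃ m, k = m + 1 := ⟨k - 1, by omega⟩
    rw [Finset.card_insert_of_notMem hx] at hk
    rw [Finset.prod_insert hx, coeff_succ_one_add_C_mul_X_mul, ih (by omega), ih (by omega)]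
    simp

/-- The generating function of the pairs of subsets of `{1, …, s}`, weighted by `a` and `b`, whose
traces on `{1, …, m}` have at least `m` elements in total, for every `m ≤ s`. -/
noncomputable def ballotSeries (a b : ℕ → R) : ℕ → PowerSeries R
  | 0 => 1
  | s + 1 => (1 + C (a (s + 1)) * X) * ((1 + C (b (s + 1)) * X) * ballotSeries a b s) -
      C (coeff s (ballotSeries a b s)) * X ^ s

/-- The two linear factors have constant term 1, so they preserve the lowest coefficient, in degree
`s`; the recursion subtracts it. Combinatorially, the pairs lost are those with exactly `s`
elements, none equal to `s + 1`. -/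
theorem coeff_ballotSeries_of_lt (a b : ℕ → R) {s k : ℕ} (hk : k < s) :
    coeff k (ballotSeries a b s) = 0 := by
  induction s generalizing k with
  | zero => omega
  | succ s ih =>
    rw [ballotSeries, map_sub, coeff_C_mul, coeff_X_pow]
    rcases k with _ | _ | k
    · rw [coeff_zero_one_add_C_mul_X_mul, coeff_zero_one_add_C_mul_X_mul]
      rcases s with _ | s
      · simp
      · simp [ih (Nat.succ_pos s)]
    · simp only [coeff_succ_one_add_C_mul_X_mul, zero_add, coeff_zero_one_add_C_mul_X_mul]
      rw [ih (show 0 < s by omega)]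
      rcases (show 1 ≤ s by omega).eq_or_lt with h | h
      · subst h; simp
      · simp [ih h, h.ne]
    · simp only [coeff_succ_one_add_C_mul_X_mul]
      rw [ih (show k < s by omega), ih (show k + 1 < s by omega)]
      rcases (show k + 2 ≤ s by omega).eq_or_lt with h | h
      · subst h; simp
      · simp [ih h, h.ne]

theorem prod_Ioc_succ (a : ℕ → R) {s n : ℕ} (h : s ≤ n) :
    ∏ i ∈ Finset.Ioc s (n + 1), (1 + C (a i) * X : PowerSeries R) =
      (1 + C (a (n + 1)) * X) * ∏ i ∈ Finset.Ioc s n, (1 + C (a i) * X) := by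
  rw [← Finset.insert_Ioc_right_eq_Ioc_add_one h, Finset.prod_insert (by simp)]

theorem prod_Ioc_eq_mul (a : ℕ → R) {s n : ℕ} (h : s + 1 ≤ n) :
    ∏ i ∈ Finset.Ioc s n, (1 + C (a i) * X : PowerSeries R) =
      (1 + C (a (s + 1)) * X) * ∏ i ∈ Finset.Ioc (s + 1) n, (1 + C (a i) * X) := by
  rw [← Finset.insert_Ioc_add_one_left_eq_Ioc (show s < n by omega), Finset.prod_insert (by simp)]

theorem coeff_ballotSeries_succ_mul_prod (a b : ℕ → R) {s n : ℕ} (h : s + 1 ≤ n) :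
    coeff n (ballotSeries a b (s + 1) * ∏ i ∈ Finset.Ioc (s + 1) n, (1 + C (a i) * X)) =
      coeff n ((1 + C (b (s + 1)) * X) *
        (ballotSeries a b s * ∏ i ∈ Finset.Ioc s n, (1 + C (a i) * X))) := by
  -- The correction term has degree at most `s + (n - s - 1) = n - 1`, so it is invisible in degree
  -- `n`.
  have hdeg : coeff n (X ^ s * ∏ i ∈ Finset.Ioc (s + 1) n, (1 + C (a i) * X)) = 0 := by
    obtain ⟨m, rfl⟩ := Nat.exists_eq_add_of_le (show s ≤ n by omega)
    rw [add_comm s m, coeff_X_pow_mul]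
    exact coeff_prod_one_add_C_mul_X_eq_zero a _ (by simp; omega)
  rw [ballotSeries, sub_mul, map_sub, mul_assoc (C _), coeff_C_mul, hdeg, mul_zero, sub_zero,
    prod_Ioc_eq_mul a h]
  congr 1
  ring

/-- A triangular array with the recurrence of the last letters of `231`-avoiding permutations has
its partial row sums given by the coefficients of `ballotSeries`. -/
theorem sum_range_eq_coeff_ballotSeries (a b : ℕ → R) (g : ℕ → ℕ → R)
    (hzero : g 0 0 = 1) (hlt : ∀ n v, n < v → g n v = 0)
    (hsucc : ∀ n v, v ≤ n + 1 →
      g (n + 1) v = a (n + 1) * g n v + b v * ∑ u ∈ Finset.range v, g n u)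
    {n s : ℕ} (hs : s ≤ n) :
    ∑ u ∈ Finset.range (s + 1), g n u =
      coeff n (ballotSeries a b s * ∏ i ∈ Finset.Ioc s n, (1 + C (a i) * X)) := by
  induction n generalizing s with
  | zero =>
    obtain rfl : s = 0 := by omega
    simp [ballotSeries, hzero]
  | succ n ih =>
    induction s with
    | zero =>
      have h0 := ih (Nat.zero_le n)
      rw [ballotSeries, one_mul] at h0 ⊢
      rw [prod_Ioc_succ a (Nat.zero_le n), coeff_succ_one_add_C_mul_X_mul, ← h0,
        coeff_prod_one_add_C_mul_X_eq_zero a _ (by simp), Finset.sum_range_one,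
        Finset.sum_range_one, hsucc n 0 (by omega)]
      simp
    | succ s ihs =>
      rw [Finset.sum_range_succ, ihs (by omega), hsucc n _ hs,
        coeff_ballotSeries_succ_mul_prod a b hs, coeff_succ_one_add_C_mul_X_mul, ih (by omega)]
      have hmul (k : ℕ) : coeff k (ballotSeries a b s *
          ∏ i ∈ Finset.Ioc s (n + 1), (1 + C (a i) * X)) = coeff k ((1 + C (a (n + 1)) * X) *
          (ballotSeries a b s * ∏ i ∈ Finset.Ioc s n, (1 + C (a i) * X))) := by
        rw [prod_Ioc_succ a (show s ≤ n by omega)]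
        congr 1
        ring
      rw [hmul n]
      rcases (show s ≤ n by omega).eq_or_lt with h | h
      · subst h
        -- On the diagonal `g n (n + 1)` is zero, matched by the vanishing of the coefficient of `X
        -- ^ (n - 1)` in `ballotSeries a b n`.
        rw [hlt s _ (by omega)]
        rcases s with _ | s
        · simp
        · have := coeff_ballotSeries_of_lt a b (Nat.lt_succ_self s)
          simp only [Nat.succ_eq_add_one] at this
          simp [coeff_succ_one_add_C_mul_X_mul, this]
      -- A single entry is the difference of two consecutive partial sums of row `n`, both known by
      -- induction.
      · have hg : g n (s + 1) = b (s + 1) * coeff (n - 1) (ballotSeries a b s *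
            ∏ i ∈ Finset.Ioc s n, (1 + C (a i) * X)) := by
          have h1 := ih (show s + 1 ≤ n by omega)
          obtain ⟨m, rfl⟩ : ∃ m, n = m + 1 := ⟨n - 1, by omega⟩
          rw [Finset.sum_range_succ, ih (show s ≤ m + 1 by omega),
            coeff_ballotSeries_succ_mul_prod a b (by omega),
            coeff_succ_one_add_C_mul_X_mul] at h1
          exact add_left_cancel h1
        obtain ⟨m, rfl⟩ : ∃ m, n = m + 1 := ⟨n - 1, by omega⟩
        rw [hg, coeff_succ_one_add_C_mul_X_mul, Nat.add_sub_cancel]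
        ring

end Algebra

/-! ### Appending a last letter to a permutation. -/

section InsertLast

open Equiv

/-- The permutation obtained from `σ` by appending the last letter `v`, after raising by one the
letters that are at least `v`. -/
def insertLast {n : ℕ} (v : Fin (n + 1)) (σ : Perm (Fin n)) : Perm (Fin (n + 1)) :=
  (finSuccEquiv' (Fin.last n)).trans ((optionCongr σ).trans (finSuccEquiv' v).symm)

variable {n : ℕ}

@[simp]
theorem insertLast_last (v : Fin (n + 1)) (σ : Perm (Fin n)) :
    insertLast v σ (Fin.last n) = v := by
  simp [insertLast]

@[simp]
theorem insertLast_castSucc (v : Fin (n + 1)) (σ : Perm (Fin n)) (i : Fin n) :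
    insertLast v σ i.castSucc = v.succAbove (σ i) := by
  have h := finSuccEquiv'_succAbove (Fin.last n) i
  rw [Fin.succAbove_last] at h
  simp [insertLast, h]

theorem insertLast_inv_self (v : Fin (n + 1)) (σ : Perm (Fin n)) :
    (insertLast v σ)⁻¹ v = Fin.last n := by
  rw [Perm.inv_eq_iff_eq, insertLast_last]

theorem insertLast_inv_succAbove (v : Fin (n + 1)) (σ : Perm (Fin n)) (x : Fin n) :
    (insertLast v σ)⁻¹ (v.succAbove x) = (σ⁻¹ x).castSucc := by
  rw [Perm.inv_eq_iff_eq, insertLast_castSucc]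
  simp

theorem insertLast_inv_of_lt (v : Fin (n + 1)) (σ : Perm (Fin n)) {x : ℕ} (hx : x < v) :
    (insertLast v σ)⁻¹ ⟨x, hx.trans v.2⟩ = (σ⁻¹ ⟨x, by omega⟩).castSucc := by
  rw [← insertLast_inv_succAbove, Fin.succAbove_of_castSucc_lt _ _ (by simpa [Fin.lt_def])]
  rfl

theorem insertLast_inv_of_le (v : Fin (n + 1)) (σ : Perm (Fin n)) {x : ℕ} (hx : v ≤ x)
    (hn : x < n) :
    (insertLast v σ)⁻¹ ⟨x + 1, by omega⟩ = (σ⁻¹ ⟨x, hn⟩).castSucc := by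
  rw [← insertLast_inv_succAbove, Fin.succAbove_of_le_castSucc _ _ (by simpa [Fin.le_def])]
  rfl

theorem insertLast_bijective :
    Function.Bijective fun p : Fin (n + 1) × Perm (Fin n) => insertLast p.1 p.2 := by
  rw [Fintype.bijective_iff_injective_and_card]
  refine ⟨?_, by simp [Fintype.card_perm, Nat.factorial_succ]⟩
  rintro ⟨v, σ⟩ ⟨w, ρ⟩ h
  have hv : v = w := by simpa using congrArg (fun τ => τ (Fin.last n)) h
  subst hv
  refine Prod.ext rfl (Equiv.ext fun i => ?_)
  simpa using congrArg (fun τ => τ i.castSucc) h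

theorem avoids231_insertLast_iff (v : Fin (n + 2)) (σ : Perm (Fin (n + 1))) :
    Avoids231 (insertLast v σ) ↔ Avoids231 σ ∧ (σ (Fin.last n)).castSucc ≤ v := by
  constructor
  · intro h
    refine ⟨fun i j k hij hjk hk => h i.castSucc j.castSucc k.castSucc (by simpa) (by simpa)
      (by simpa), ?_⟩
    by_contra! hlt
    -- The letter `v` of `σ` comes before the larger last letter.
    have hvn : (v : ℕ) < n + 1 := by
      have := (σ (Fin.last n)).2
      simp only [Fin.lt_def, Fin.val_castSucc] at hlt
      omega
    set x : Fin (n + 1) := ⟨v, hvn⟩ with hx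
    have hxl : x < σ (Fin.last n) := by simpa [Fin.lt_def, hx] using hlt
    have hil : σ⁻¹ x < Fin.last n := by
      refine lt_of_le_of_ne (Fin.le_last _) fun he => ?_
      rw [Perm.inv_eq_iff_eq] at he
      exact hxl.ne he
    refine h (σ⁻¹ x).castSucc (Fin.last n).castSucc (Fin.last (n + 1)) (by simpa)
      (Fin.castSucc_lt_last _) ⟨?_, by simpa⟩
    rw [insertLast_last, insertLast_castSucc,
      Fin.lt_succAbove_iff_le_castSucc]
    simp [hx]
  · rintro ⟨h, hv⟩ i j k hij hjk ⟨hki, hij'⟩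
    obtain ⟨i, rfl⟩ := Fin.exists_castSucc_eq.2
      (((hij.trans hjk).trans_le (Fin.le_last k)).ne)
    obtain ⟨j, rfl⟩ := Fin.exists_castSucc_eq.2 ((hjk.trans_le (Fin.le_last k)).ne)
    simp only [insertLast_castSucc, Fin.succAbove_lt_succAbove_iff,
      Fin.castSucc_lt_castSucc_iff] at hki hij hij'
    induction k using Fin.lastCases with
    | cast k =>
      simp only [insertLast_castSucc, Fin.succAbove_lt_succAbove_iff] at hki
      exact h i j k hij (by simpa using hjk) ⟨hki, hij'⟩
    | last =>
      rw [insertLast_last, Fin.lt_succAbove_iff_le_castSucc] at hki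
      -- A pattern ending at the new letter can be moved to end at the old last letter, which is no
      -- larger than `v`.
      have hle : σ (Fin.last n) ≤ σ i := by simpa using hv.trans hki
      rcases (Fin.le_last j).eq_or_lt with rfl | hj
      · exact absurd hij' hle.not_gt
      · refine h i j (Fin.last n) hij hj ⟨lt_of_le_of_ne hle fun he => ?_, hij'⟩
        exact (hij.trans hj).ne' (σ.injective he)

/-! ### Effect of the insertion on descents and inverse ascents. -/

theorem succ_mem_Des_iff {σ : Perm (Fin n)} {k : ℕ} :
    k + 1 ∈ Des σ ↔ ∃ h : k + 1 < n, σ ⟨k + 1, h⟩ < σ ⟨k, by omega⟩ := by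
  simp only [Des, Finset.mem_filter, Finset.mem_Ico, Nat.add_sub_cancel]
  exact ⟨fun h => h.2, fun ⟨h, h'⟩ => ⟨⟨by omega, h⟩, h, h'⟩⟩

theorem Des_subset_Ico (σ : Perm (Fin n)) : Des σ ⊆ Finset.Ico 1 n :=
  Finset.filter_subset _ _

/-- The ascent set of `σ`, with positions numbered from `1`. -/
def Asc (σ : Perm (Fin n)) : Finset ℕ := Finset.Ico 1 n \ Des σ

theorem zero_notMem_Asc (σ : Perm (Fin n)) : 0 ∉ Asc σ := by
  simp [Asc]

theorem succ_mem_Asc_iff {σ : Perm (Fin n)} {k : ℕ} :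
    k + 1 ∈ Asc σ ↔ ∃ h : k + 1 < n, σ ⟨k, by omega⟩ < σ ⟨k + 1, h⟩ := by
  simp only [Asc, Finset.mem_sdiff, Finset.mem_Ico, succ_mem_Des_iff, not_exists, not_lt]
  refine ⟨fun ⟨h, h'⟩ => ⟨h.2, lt_of_le_of_ne (h' h.2) fun he => ?_⟩,
    fun ⟨h, h'⟩ => ⟨⟨by omega, h⟩, fun _ => h'.le⟩⟩
  simpa using σ.injective he

/-- Descents and ascents partition `{1, …, n - 1}`, whose sum is `n.choose 2`. -/
theorem choose_two_sub_imaj (σ : Perm (Fin n)) : n.choose 2 - imaj σ = ∑ i ∈ Asc σ⁻¹, i := by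
  have h := Finset.sum_sdiff (f := fun i => i) (Des_subset_Ico σ⁻¹)
  have hr : ∑ i ∈ Finset.Ico 1 n, i = n.choose 2 := by
    rw [Nat.choose_two_right, ← Finset.sum_range_id]
    rcases n with _ | n
    · simp
    · rw [Finset.range_eq_Ico, Finset.sum_eq_sum_Ico_succ_bot (Nat.succ_pos n), zero_add]
  rw [← hr, ← h, imaj, maj, Asc, Nat.add_sub_cancel]

theorem maj_insertLast (v : Fin (n + 2)) (σ : Perm (Fin (n + 1)))
    (hv : (σ (Fin.last n)).castSucc ≤ v) :
    maj (insertLast v σ) =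
      maj σ + if (σ (Fin.last n) : ℕ) = v then n + 1 else 0 := by
  have hmem (k : ℕ) (hk : k < n) : k + 1 ∈ Des (insertLast v σ) ↔ k + 1 ∈ Des σ := by
    have h1 := insertLast_castSucc v σ ⟨k, by omega⟩
    have h2 := insertLast_castSucc v σ ⟨k + 1, by omega⟩
    simp only [Fin.castSucc_mk] at h1 h2
    rw [succ_mem_Des_iff, succ_mem_Des_iff]
    simp only [h1, h2, Fin.succAbove_lt_succAbove_iff]
    exact ⟨fun ⟨_, h⟩ => ⟨by omega, h⟩, fun ⟨_, h⟩ => ⟨by omega, h⟩⟩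
  have hlast : n + 1 ∈ Des (insertLast v σ) ↔ (σ (Fin.last n) : ℕ) = v := by
    have h1 := insertLast_castSucc v σ (Fin.last n)
    have h2 := insertLast_last v σ
    simp only [Fin.last, Fin.castSucc_mk] at h1 h2 hv ⊢
    rw [succ_mem_Des_iff]
    simp only [h1, h2, Fin.lt_succAbove_iff_le_castSucc]
    simp only [Fin.le_def, Fin.val_castSucc] at hv ⊢
    constructor
    · rintro ⟨_, h⟩; omega
    · intro h; exact ⟨by omega, h.ge⟩
  have hnot : n + 1 ∉ Des σ := fun h => by
    have := Finset.mem_Ico.1 (Des_subset_Ico σ h)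
    omega
  have hset : Des (insertLast v σ) =
      if (σ (Fin.last n) : ℕ) = v then insert (n + 1) (Des σ) else Des σ := by
    ext i
    rcases i with _ | k
    · have h0 {m : ℕ} (ρ : Perm (Fin m)) : 0 ∉ Des ρ := fun h => by
        have := Finset.mem_Ico.1 (Des_subset_Ico ρ h)
        omega
      split_ifs <;> simp [h0]
    · rcases lt_trichotomy k n with hk | rfl | hk
      · rw [hmem k hk]
        split_ifs
        · simp [hk.ne]
        · rfl
      · rw [hlast]
        split_ifs with h <;> simp [h, hnot]
      · have h1 : k + 1 ∉ Des (insertLast v σ) := fun h => by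
          have := Finset.mem_Ico.1 (Des_subset_Ico _ h)
          omega
        have h2 : k + 1 ∉ Des σ := fun h => by
          have := Finset.mem_Ico.1 (Des_subset_Ico _ h)
          omega
        split_ifs <;> simp [h1, h2, hk.ne']
  rw [maj, hset]
  split_ifs
  · rw [Finset.sum_insert hnot, maj, add_comm]
  · simp [maj]

/-- In a `231`-avoiding permutation the letters from the last one on appear in decreasing order. -/
theorem Avoids231.inv_succ_lt {σ : Perm (Fin (n + 1))} (h : Avoids231 σ) {x : ℕ}
    (hx : x + 1 < n + 1) (hle : (σ (Fin.last n) : ℕ) ≤ x) :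
    σ⁻¹ ⟨x + 1, hx⟩ < σ⁻¹ ⟨x, by omega⟩ := by
  by_contra! hlt
  have hlt' : σ⁻¹ ⟨x, by omega⟩ < σ⁻¹ ⟨x + 1, hx⟩ :=
    lt_of_le_of_ne hlt fun he => by simpa using σ⁻¹.injective he
  have hne : σ⁻¹ ⟨x + 1, hx⟩ ≠ Fin.last n := fun he => by
    rw [Perm.inv_eq_iff_eq] at he
    have := congrArg Fin.val he
    simp only at this
    omega
  have hlast := lt_of_le_of_ne (Fin.le_last _) hne
  refine h _ _ _ hlt' hlast ⟨?_, by simp [Fin.lt_def]⟩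
  refine lt_of_le_of_ne (by simpa [Fin.le_def]) fun he => ?_
  exact (hlt'.trans hlast).ne' (σ.injective he)

/-- Comparisons of letters below `v` do not change. The letter `v` now stands last, so `v` is an
ascent of the inverse whenever it is positive. Above `v` the shift of letters is harmless: they
appear in decreasing order and give no ascents before or after. If the old last letter was `v`, the
ascent was already there. -/
theorem Asc_inv_insertLast (v : Fin (n + 2)) {σ : Perm (Fin (n + 1))} (hσ : Avoids231 σ)
    (hv : (σ (Fin.last n)).castSucc ≤ v) :
    Asc (insertLast v σ)⁻¹ =
      if (σ (Fin.last n) : ℕ) = v then Asc σ⁻¹ else insert (v : ℕ) (Asc σ⁻¹) := by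
  have hv' : (σ (Fin.last n) : ℕ) ≤ v := by simpa [Fin.le_def] using hv
  ext i
  rcases i with _ | k
  · split_ifs
    · simp [zero_notMem_Asc]
    · simp [zero_notMem_Asc, show (0 : ℕ) ≠ v by omega]
  have hvn : (v : ℕ) < n + 2 := v.2
  have hold (h : (v : ℕ) ≤ k) : k + 1 ∉ Asc σ⁻¹ := by
    rw [succ_mem_Asc_iff]
    rintro ⟨hk, hlt⟩
    exact (hσ.inv_succ_lt hk (by omega)).asymm hlt
  rcases lt_trichotomy (k + 1) v with hk | hk | hk
  · have h : k + 1 ∈ Asc (insertLast v σ)⁻¹ ↔ k + 1 ∈ Asc σ⁻¹ := by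
      rw [succ_mem_Asc_iff, succ_mem_Asc_iff]
      simp only [insertLast_inv_of_lt v σ hk, insertLast_inv_of_lt v σ (show k < v by omega),
        Fin.castSucc_lt_castSucc_iff]
      exact ⟨fun ⟨_, h⟩ => ⟨by omega, h⟩, fun ⟨_, h⟩ => ⟨by omega, h⟩⟩
    rw [h]
    split_ifs
    · rfl
    · simp [hk.ne]
  · have h : k + 1 ∈ Asc (insertLast v σ)⁻¹ := by
      rw [succ_mem_Asc_iff]
      refine ⟨by omega, ?_⟩
      rw [insertLast_inv_of_lt v σ (show k < v by omega)]
      simp only [hk, Fin.eta, insertLast_inv_self]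
      exact Fin.castSucc_lt_last _
    simp only [h, true_iff]
    split_ifs with he
    · rw [succ_mem_Asc_iff]
      refine ⟨by have := (σ (Fin.last n)).2; omega, ?_⟩
      have hl : σ⁻¹ ⟨k + 1, by have := (σ (Fin.last n)).2; omega⟩ = Fin.last n := by
        rw [Perm.inv_eq_iff_eq, Fin.ext_iff]
        simp only
        omega
      rw [hl]
      refine lt_of_le_of_ne (Fin.le_last _) fun h' => ?_
      rw [← hl] at h'
      simpa using σ⁻¹.injective h'
    · simp [hk]
  · have h : k + 1 ∉ Asc (insertLast v σ)⁻¹ := by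
      rw [succ_mem_Asc_iff]
      rintro ⟨hkn, hlt⟩
      rw [insertLast_inv_of_le v σ (show (v : ℕ) ≤ k by omega) (by omega)] at hlt
      rcases (show (v : ℕ) ≤ k by omega).eq_or_lt with he | he
      · simp only [← he, Fin.eta, insertLast_inv_self] at hlt
        exact (Fin.le_last _).not_gt hlt
      · obtain ⟨m, rfl⟩ : ∃ m, k = m + 1 := ⟨k - 1, by omega⟩
        rw [insertLast_inv_of_le v σ (show (v : ℕ) ≤ m by omega) (by omega),
          Fin.castSucc_lt_castSucc_iff] at hlt
        exact (hσ.inv_succ_lt (by omega) (by omega)).asymm hlt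
    simp only [h, false_iff]
    split_ifs
    · exact hold (by omega)
    · simp [hold (show (v : ℕ) ≤ k by omega), hk.ne']

theorem notMem_Asc_inv {σ : Perm (Fin (n + 1))} (hσ : Avoids231 σ) {x : ℕ}
    (hx : (σ (Fin.last n) : ℕ) < x) : x ∉ Asc σ⁻¹ := by
  obtain ⟨m, rfl⟩ : ∃ m, x = m + 1 := ⟨x - 1, by omega⟩
  rw [succ_mem_Asc_iff]
  rintro ⟨hk, hlt⟩
  exact (hσ.inv_succ_lt hk (by omega)).asymm hlt

end InsertLast

/-! ### Weighted sums by last letter. -/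

section Sums

open Equiv

/-- The monomial of `σ` in `A n`. -/
noncomputable def weight {n : ℕ} (σ : Perm (Fin n)) : Poly :=
  q ^ maj σ * t ^ (n.choose 2 - imaj σ)

theorem weight_insertLast {n : ℕ} (v : Fin (n + 2)) {σ : Perm (Fin (n + 1))} (hσ : Avoids231 σ)
    (hv : (σ (Fin.last n)).castSucc ≤ v) :
    weight (insertLast v σ) =
      (if (σ (Fin.last n) : ℕ) = v then q ^ (n + 1) else t ^ (v : ℕ)) * weight σ := by
  have hv' : (σ (Fin.last n) : ℕ) ≤ v := by simpa [Fin.le_def] using hv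
  rw [weight, weight, choose_two_sub_imaj, choose_two_sub_imaj, Asc_inv_insertLast v hσ hv,
    maj_insertLast v σ hv]
  split_ifs with h
  · ring
  · rw [Finset.sum_insert (notMem_Asc_inv hσ (by omega))]
    ring

/-- The part of `A (n + 1)` that comes from the permutations whose last letter is `v`, with the
letters numbered from `0`. -/
noncomputable def lastLetterSum (n v : ℕ) : Poly :=
  ∑ σ : Perm (Fin (n + 1)) with Avoids231 σ ∧ (σ (Fin.last n) : ℕ) = v, weight σ

theorem lastLetterSum_eq_zero {n v : ℕ} (h : n < v) : lastLetterSum n v = 0 := by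
  refine Finset.sum_eq_zero fun σ hσ => ?_
  have := (Finset.mem_filter.1 hσ).2.2
  omega

theorem lastLetterSum_zero_zero : lastLetterSum 0 0 = 1 := by
  have h : (Finset.univ.filter fun σ : Perm (Fin 1) =>
      Avoids231 σ ∧ (σ (Fin.last 0) : ℕ) = 0) = {1} := by decide
  rw [lastLetterSum, h, Finset.sum_singleton, weight, choose_two_sub_imaj,
    show maj (1 : Perm (Fin 1)) = 0 by decide, show Asc (1 : Perm (Fin 1))⁻¹ = ∅ by decide]
  simp

theorem sum_range_lastLetterSum (n m : ℕ) :
    ∑ u ∈ Finset.range m, lastLetterSum n u =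
      ∑ σ : Perm (Fin (n + 1)) with Avoids231 σ ∧ (σ (Fin.last n) : ℕ) < m, weight σ := by
  simp only [lastLetterSum, Finset.sum_filter]
  rw [Finset.sum_comm]
  refine Finset.sum_congr rfl fun σ _ => ?_
  by_cases hσ : Avoids231 σ <;> simp [hσ]

theorem A_succ (n : ℕ) : A (n + 1) = ∑ u ∈ Finset.range (n + 1), lastLetterSum n u := by
  rw [sum_range_lastLetterSum, A]
  refine Finset.sum_congr (Finset.filter_congr fun σ _ => ?_) fun _ _ => rfl
  exact ⟨fun h => ⟨h, (σ (Fin.last n)).2⟩, And.left⟩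

theorem A_zero : A 0 = 1 := by
  have h : (Finset.univ.filter fun σ : Perm (Fin 0) => Avoids231 σ) = {1} := by decide
  rw [A, h, Finset.sum_singleton, show maj (1 : Perm (Fin 0)) = 0 by decide]
  simp

theorem lastLetterSum_succ (n v : ℕ) (hv : v ≤ n + 1) :
    lastLetterSum (n + 1) v =
      q ^ (n + 1) * lastLetterSum n v + t ^ v * ∑ u ∈ Finset.range v, lastLetterSum n u := by
  obtain ⟨v, rfl⟩ : ∃ w : Fin (n + 2), (w : ℕ) = v := ⟨⟨v, by omega⟩, rfl⟩
  have h : lastLetterSum (n + 1) v =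
      ∑ σ : Perm (Fin (n + 1)) with Avoids231 σ ∧ (σ (Fin.last n)).castSucc ≤ v,
        weight (insertLast v σ) := by
    symm
    refine Finset.sum_nbij (insertLast v) (fun σ hσ => ?_) (fun σ _ ρ _ hσρ => ?_)
      (fun τ hτ => ?_) fun _ _ => rfl
    · simpa [avoids231_insertLast_iff] using hσ
    · exact congrArg Prod.snd ((@insertLast_bijective (n + 1)).1 (a₁ := (v, σ)) (a₂ := (v, ρ)) hσρ)
    · obtain ⟨⟨w, σ⟩, rfl⟩ := (@insertLast_bijective (n + 1)).2 τ
      simp only [Finset.coe_filter, Finset.mem_univ, true_and, Set.mem_ofPred_eq,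
        insertLast_last, Fin.val_inj] at hτ
      obtain ⟨hτ, rfl⟩ := hτ
      exact ⟨σ, by simpa [avoids231_insertLast_iff] using hτ, rfl⟩
  rw [h, sum_range_lastLetterSum, lastLetterSum, Finset.mul_sum, Finset.mul_sum,
    Finset.sum_filter, Finset.sum_filter, Finset.sum_filter, ← Finset.sum_add_distrib]
  refine Finset.sum_congr rfl fun σ _ => ?_
  by_cases hσ : Avoids231 σ
  · rcases lt_trichotomy (σ (Fin.last n) : ℕ) v with hlt | heq | hgt
    · have hle : (σ (Fin.last n)).castSucc ≤ v := by simpa [Fin.le_def] using hlt.le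
      simp [hσ, hle, hlt, hlt.ne, weight_insertLast v hσ hle]
    · have hle : (σ (Fin.last n)).castSucc ≤ v := by simpa [Fin.le_def] using heq.le
      simp [hσ, hle, heq, weight_insertLast v hσ hle]
    · have hle : ¬ (σ (Fin.last n)).castSucc ≤ v := by simpa [Fin.le_def] using hgt
      simp [hσ, hle, hgt.ne', hgt.not_gt]
  · simp [hσ]

theorem A_succ_eq_coeff_ballotSeries (n : ℕ) :
    A (n + 1) = PowerSeries.coeff n (ballotSeries (fun i => q ^ i) (fun i => t ^ i) n) := by
  rw [A_succ, sum_range_eq_coeff_ballotSeries (fun i => q ^ i) (fun i => t ^ i) lastLetterSum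
    lastLetterSum_zero_zero (fun _ _ => lastLetterSum_eq_zero) lastLetterSum_succ le_rfl]
  simp

/-! ### Telescoping of the summands. -/

theorem denom_succ (n : ℕ) :
    denom (n + 1) = (1 + PowerSeries.C (q ^ (n + 1)) * PowerSeries.X) *
      ((1 + PowerSeries.C (t ^ (n + 1)) * PowerSeries.X) * denom n) := by
  rw [denom, denom, ← Finset.insert_Icc_right_eq_Icc_add_one (Nat.zero_le (n + 1)),
    ← Finset.insert_Icc_right_eq_Icc_add_one (Nat.succ_le_succ (Nat.zero_le n)),
    Finset.prod_insert (by simp), Finset.prod_insert (by simp)]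
  ring

theorem denomInv_eq_mul_denomInv_succ (n : ℕ) :
    denomInv n = (1 + PowerSeries.C (q ^ (n + 1)) * PowerSeries.X) *
      ((1 + PowerSeries.C (t ^ (n + 1)) * PowerSeries.X) * denomInv (n + 1)) := by
  have h := denom_mul_denomInv (n + 1)
  rw [denom_succ] at h
  linear_combination (-denomInv n) * h + ((1 + PowerSeries.C (q ^ (n + 1)) * PowerSeries.X) *
      ((1 + PowerSeries.C (t ^ (n + 1)) * PowerSeries.X) * denomInv (n + 1))) *
        denom_mul_denomInv n

/-- With `A (N + 1)` as the subtracted coefficient, `A (N + 1) * X ^ (N + 1) + X * B_{N+1}` equals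
`X * B_N` times the two factors that `denom (N + 1)` has beyond `denom N`. -/
theorem sum_range_summand_add (N : ℕ) :
    ∑ n ∈ Finset.range (N + 1), summand n +
      PowerSeries.X * ballotSeries (fun i => q ^ i) (fun i => t ^ i) N * denomInv N = 1 := by
  induction N with
  | zero =>
    have h := denom_mul_denomInv 0
    simp only [denom, Finset.Icc_self, Finset.prod_singleton, pow_zero, map_one, one_mul,
      Finset.Icc_eq_empty_of_lt zero_lt_one, Finset.prod_empty, mul_one] at h
    simp only [zero_add, Finset.sum_range_one, summand, A_zero, ballotSeries, map_one, pow_zero]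
    linear_combination h
  | succ N ih =>
    rw [← ih, Finset.sum_range_succ, summand, A_succ_eq_coeff_ballotSeries, ballotSeries,
      denomInv_eq_mul_denomInv_succ N]
    ring

end Sums

end Perm231

/-- The identity holds in `ℤ[q,t]⟦z⟧`, where an infinite sum converges coefficientwise, with every
coefficient eventually constant (the product topology for the discrete topology on `ℤ[q,t]`). -/
theorem theorem4p2 :
    letI : TopologicalSpace Perm231.Poly := ⊥
    HasSum (fun n : ℕ => Perm231.summand n) (1 : PowerSeries Perm231.Poly) := by
  let : TopologicalSpace Perm231.Poly := ⊥
  rw [PowerSeries.WithPiTopology.hasSum_iff_hasSum_coeff]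
  intro d
  -- Only the summands with index at most `d` reach degree `d`, so the partial sum up to `d` settles
  -- this coefficient.
  have hzero (m : ℕ) (hm : m ∉ Finset.range (d + 1)) :
      PowerSeries.coeff d (Perm231.summand m) = 0 := by
    rw [Perm231.summand, mul_assoc, PowerSeries.coeff_C_mul, PowerSeries.coeff_X_pow_mul',
      if_neg (by simpa using hm), mul_zero]
  have hrest : PowerSeries.coeff d (PowerSeries.X *
      Perm231.ballotSeries (fun i => Perm231.q ^ i) (fun i => Perm231.t ^ i) d *
        Perm231.denomInv d) = 0 := by
    have hdvd : PowerSeries.X ^ (d + 1) ∣ PowerSeries.X *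
        Perm231.ballotSeries (fun i => Perm231.q ^ i) (fun i => Perm231.t ^ i) d := by
      rw [pow_succ']
      exact mul_dvd_mul_left _ (PowerSeries.X_pow_dvd_iff.2 fun _ =>
        Perm231.coeff_ballotSeries_of_lt _ _)
    exact PowerSeries.X_pow_dvd_iff.1 (hdvd.mul_right _) d (Nat.lt_succ_self d)
  have hsum := hasSum_sum_of_ne_finset_zero (L := .unconditional ℕ) hzero
  rwa [← map_sum, eq_sub_of_add_eq (Perm231.sum_range_summand_add d), map_sub, hrest,
    sub_zero] at hsum
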